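/- Let $F$ be a (real) Banach lattice, and for $f\in F$ write $f^{+}=f\vee 0$ and $f^{-}=(-f)\vee 0$. A (linear) sublattice of $F$ is a linear subspace closed under $\vee$ and $\wedge$; for $A\subset F$ let $\mathrm{vlt}(A)$ denote the smallest linear sublattice of $F$ containing $A$. Let $A\subset F_{+}=\{f\in F: f\ge 0\}$. Then: (1) for all $r,s\in\mathbb{R}$ with $s\neq -r$, with $\Phi:F\to F$ defined by $\Phi(f)=rf^{+}+sf^{-}$, the norm closure of $\mathrm{span}\{\Phi(f): f\in\mathrm{span}\,A\}$ is the closed sublattice of $F$ generated by $A$, i.e. it is a norm-closed linear sublattice containing $A$ and is contained in every norm-closed linear sublattice of $F$ containing $A$; moreover it equals the norm closure of $\mathrm{vlt}(A)$; (2) in particular, $\overline{\mathrm{vlt}(A)}=\overline{\mathrm{span}\{f^{+}: f\in\mathrm{span}\,A\}}$, where the closures are taken in the norm topology. -/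

import Mathlib

/-- A linear subspace of a vector lattice is a (linear) sublattice if it is closed under the
binary lattice operations. -/
def IsVectorSublattice {F : Type*} [AddCommGroup F] [Module ℝ F] [Lattice F]
    (S : Submodule ℝ F) : Prop :=
  SupClosed (S : Set F) ∧ InfClosed (S : Set F)

/-- `vlt A` is the linear sublattice generated by `A`: the intersection of all linear sublattices
that contain `A`. -/
def vlt {F : Type*} [AddCommGroup F] [Module ℝ F] [Lattice F] (A : Set F) : Submodule ℝ F :=
  sInf {S : Submodule ℝ F | IsVectorSublattice S ∧ A ⊆ S}

/-- The map `Φ f = r f⁺ + s f⁻`, where `f⁺ = f ⊔ 0` and `f⁻ = (-f) ⊔ 0`. -/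
def latticeActivation {F : Type*} [AddCommGroup F] [Module ℝ F] [Lattice F]
    (r s : ℝ) (f : F) : F :=
  r • f⁺ + s • f⁻

/-! ### Vector-lattice algebra: reduction of `Φ` to positive parts, and the lattice generated by a
subspace. -/

section VectorLattice

variable {F : Type*} [AddCommGroup F] [Module ℝ F] [Lattice F]

/-! Since `Φ f + Φ (-f) = (r + s)|f|` and `A` is positive, the spans of `Φ f` and of `f⁺` agree
(`span_latticeActivation_eq`). Every sublattice containing `A` contains the latter span, so it
remains to see that its closure is closed under `|·|`. By continuity of `|·|` and finiteness of
linear combinations, it suffices to treat `|u|` for `u` built from finitely many positive `a i`.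
Replacing `a i` by the coordinate `x i` turns `u` into a function on the standard simplex. There
`|u|` is uniformly within any `δ > 0` of a combination of positive parts of linear forms
(`reluSpan_eq_top`). That estimate is a lattice-linear inequality on the simplex, so it passes to
`F` (`snd_nonpos_of_fst_nonpos`) with error at most `δ • ∑ i, a i`, and the norm is solid. -/

lemma IsVectorSublattice.posPart_mem {S : Submodule ℝ F} (hS : IsVectorSublattice S) {x : F}
    (hx : x ∈ S) : x⁺ ∈ S :=
  hS.1 hx S.zero_mem

lemma IsVectorSublattice.abs_mem {S : Submodule ℝ F} (hS : IsVectorSublattice S) {x : F}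
    (hx : x ∈ S) : |x| ∈ S :=
  hS.1 hx (S.neg_mem hx)

section

variable [IsOrderedModule ℝ F]

lemma smul_sup_of_nonneg {c : ℝ} (hc : 0 ≤ c) (x y : F) : c • (x ⊔ y) = c • x ⊔ c • y := by
  rcases hc.eq_or_lt with rfl | hc
  · simp
  · exact (OrderIso.smulRight hc).map_sup x y

lemma smul_inf_of_nonneg {c : ℝ} (hc : 0 ≤ c) (x y : F) : c • (x ⊓ y) = c • x ⊓ c • y := by
  rcases hc.eq_or_lt with rfl | hc
  · simp
  · exact (OrderIso.smulRight hc).map_inf x y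

end

variable [IsOrderedAddMonoid F]

/-- A linear subspace closed under absolute values is a sublattice. -/
lemma isVectorSublattice_of_abs_mem {S : Submodule ℝ F} (h : ∀ x ∈ S, |x| ∈ S) :
    IsVectorSublattice S := by
  constructor
  · intro a ha b hb
    rw [sup_eq_half_smul_add_add_abs_sub' ℝ]
    exact S.smul_mem _ (S.add_mem (S.add_mem ha hb) (h _ (S.sub_mem hb ha)))
  · intro a ha b hb
    rw [inf_eq_half_smul_add_sub_abs_sub' ℝ]
    exact S.smul_mem _ (S.sub_mem (S.add_mem ha hb) (h _ (S.sub_mem hb ha)))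

/-- Translations preserve `⊔` and `⊓`, so minimality of the closure applies twice: to translation by
`v ∈ G`, then by an element of the closure. -/
lemma add_mem_latticeClosure (G : Submodule ℝ F) {x y : F} (hx : x ∈ latticeClosure (G : Set F))
    (hy : y ∈ latticeClosure (G : Set F)) : x + y ∈ latticeClosure (G : Set F) := by
  have hl := isSublattice_latticeClosure (s := (G : Set F))
  have key : ∀ v ∈ G, latticeClosure (G : Set F) ⊆ {u | u + v ∈ latticeClosure (G : Set F)} := by
    intro v hv
    refine latticeClosure_min (fun u hu => subset_latticeClosure (G.add_mem hu hv)) ⟨?_, ?_⟩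
    · intro a ha b hb
      simpa only [Set.mem_ofPred_eq, sup_add] using hl.1 ha hb
    · intro a ha b hb
      simpa only [Set.mem_ofPred_eq, inf_add] using hl.2 ha hb
  have : latticeClosure (G : Set F) ⊆ {u | x + u ∈ latticeClosure (G : Set F)} := by
    refine latticeClosure_min (fun u hu => key u hu hx) ⟨?_, ?_⟩
    · intro a ha b hb
      simpa only [Set.mem_ofPred_eq, add_sup] using hl.1 ha hb
    · intro a ha b hb
      simpa only [Set.mem_ofPred_eq, add_inf] using hl.2 ha hb
  exact this hy

/-- The span of the image of `Φ` is the span of the positive parts. -/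
lemma span_latticeActivation_eq (A : Set F) (hA : ∀ a ∈ A, 0 ≤ a) {r s : ℝ} (hrs : s ≠ -r) :
    Submodule.span ℝ (latticeActivation r s '' (Submodule.span ℝ A : Set F)) =
      Submodule.span ℝ ((fun f : F => f⁺) '' (Submodule.span ℝ A : Set F)) := by
  have hrs' : r + s ≠ 0 := fun h => hrs (by linarith)
  apply le_antisymm
  · rw [Submodule.span_le]
    rintro _ ⟨f, hf, rfl⟩
    refine add_mem (Submodule.smul_mem _ _ (Submodule.subset_span ⟨f, hf, rfl⟩))
      (Submodule.smul_mem _ _ (Submodule.subset_span ⟨-f, neg_mem hf, ?_⟩))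
    simp
  · set T := Submodule.span ℝ (latticeActivation r s '' (Submodule.span ℝ A : Set F))
    have habs : ∀ f ∈ Submodule.span ℝ A, |f| ∈ T := by
      intro f hf
      have h1 : latticeActivation r s f ∈ T := Submodule.subset_span ⟨f, hf, rfl⟩
      have h2 : latticeActivation r s (-f) ∈ T := Submodule.subset_span ⟨-f, neg_mem hf, rfl⟩
      have h3 : |f| = (r + s)⁻¹ • (latticeActivation r s f + latticeActivation r s (-f)) := by
        rw [eq_inv_smul_iff₀ hrs', ← posPart_add_negPart]
        simp only [latticeActivation, posPart_neg, negPart_neg]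
        module
      rw [h3]
      exact T.smul_mem _ (T.add_mem h1 h2)
    -- Positivity of `A` enters here: `a = |a|`.
    have hle : Submodule.span ℝ A ≤ T := by
      rw [Submodule.span_le]
      intro a ha
      have := habs a (Submodule.subset_span ha)
      rwa [abs_of_nonneg (hA a ha)] at this
    rw [Submodule.span_le]
    rintro _ ⟨f, hf, rfl⟩
    have h : f⁺ = (2⁻¹ : ℝ) • (f + |f|) := by
      rw [add_abs_eq_two_nsmul_posPart, ← Nat.cast_smul_eq_nsmul ℝ, smul_smul]
      norm_num
    change f⁺ ∈ T
    rw [h]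
    exact T.smul_mem _ (T.add_mem (hle hf) (habs f hf))

variable [IsOrderedModule ℝ F]

lemma smul_mem_latticeClosure (G : Submodule ℝ F) (c : ℝ) {x : F}
    (hx : x ∈ latticeClosure (G : Set F)) : c • x ∈ latticeClosure (G : Set F) := by
  have hl := isSublattice_latticeClosure (s := (G : Set F))
  have : latticeClosure (G : Set F) ⊆ {u | c • u ∈ latticeClosure (G : Set F)} := by
    refine latticeClosure_min (fun u hu => subset_latticeClosure (G.smul_mem c hu)) ?_
    rcases le_total 0 c with hc | hc
    · constructor <;> intro a ha b hb
      · simpa only [Set.mem_ofPred_eq, smul_sup_of_nonneg hc] using hl.1 ha hb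
      · simpa only [Set.mem_ofPred_eq, smul_inf_of_nonneg hc] using hl.2 ha hb
    · obtain ⟨d, rfl⟩ : ∃ d, c = -d := ⟨-c, by simp⟩
      have hd : 0 ≤ d := by linarith
      constructor <;> intro a ha b hb
      · simpa only [Set.mem_ofPred_eq, neg_smul, smul_sup_of_nonneg hd, neg_sup] using hl.2 ha hb
      · simpa only [Set.mem_ofPred_eq, neg_smul, smul_inf_of_nonneg hd, neg_inf] using hl.1 ha hb
  exact this hx

/-- The lattice generated by a linear subspace, as a linear subspace. -/
def submoduleLatticeClosure (G : Submodule ℝ F) : Submodule ℝ F where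
  carrier := latticeClosure (G : Set F)
  zero_mem' := subset_latticeClosure G.zero_mem
  add_mem' := add_mem_latticeClosure G
  smul_mem' c _ := smul_mem_latticeClosure G c

lemma isVectorSublattice_submoduleLatticeClosure (G : Submodule ℝ F) :
    IsVectorSublattice (submoduleLatticeClosure G) :=
  have h := isSublattice_latticeClosure (s := (G : Set F))
  ⟨h.1, h.2⟩

lemma le_submoduleLatticeClosure (G : Submodule ℝ F) : G ≤ submoduleLatticeClosure G :=
  subset_latticeClosure (s := (G : Set F))

/-- Every element of the lattice generated by `G` is a finite supremum of finite infima. -/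
lemma mem_supClosure_infClosure_of_mem {G : Submodule ℝ F} {x : F}
    (hx : x ∈ submoduleLatticeClosure G) : x ∈ supClosure (infClosure (G : Set F)) := by
  -- Distributivity, automatic in lattice-ordered groups, gives the sup-of-infs normal form.
  let _ : DistribLattice F := AddCommGroup.toDistribLattice F
  have h := supClosure_infClosure (G : Set F)
  exact h.symm ▸ hx

end VectorLattice

/-! ### Transfer of inequalities from the simplex to a vector lattice. -/

section Transfer

instance {X : Type*} [TopologicalSpace X] : IsOrderedModule ℝ C(X, ℝ) where
  smul_le_smul_of_nonneg_left _ hc _ _ h x := mul_le_mul_of_nonneg_left (h x) hc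
  smul_le_smul_of_nonneg_right _ hf _ _ h x := mul_le_mul_of_nonneg_right h (hf x)

instance {X : Type*} [TopologicalSpace X] [CompactSpace X] : HasSolidNorm C(X, ℝ) where
  solid f g h := (ContinuousMap.norm_le f (norm_nonneg g)).2 fun x =>
    (show |f x| ≤ |g x| from h x).trans (g.norm_coe_le_norm x)

instance {E F : Type*} [AddCommGroup E] [Module ℝ E] [PartialOrder E] [IsOrderedModule ℝ E]
    [AddCommGroup F] [Module ℝ F] [PartialOrder F] [IsOrderedModule ℝ F] :
    IsOrderedModule ℝ (E × F) where
  smul_le_smul_of_nonneg_left _ hc _ _ h :=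
    ⟨smul_le_smul_of_nonneg_left h.1 hc, smul_le_smul_of_nonneg_left h.2 hc⟩
  smul_le_smul_of_nonneg_right _ hf _ _ h :=
    ⟨smul_le_smul_of_nonneg_right h hf.1, smul_le_smul_of_nonneg_right h hf.2⟩

variable {ι : Type*} [Fintype ι]

/-- A form of the theorem of the alternative: if finitely many linear forms have a pointwise
nonpositive minimum on the standard simplex, then some convex combination has nonpositive
coefficients. -/
lemma exists_convexHull_nonpos (s : Finset (ι → ℝ))
    (h : ∀ x ∈ stdSimplex ℝ ι, ∃ c ∈ s, ∑ i, c i * x i ≤ 0) :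
    (∃ c ∈ convexHull ℝ (s : Set (ι → ℝ)), c ≤ 0) ∨ IsEmpty ι := by
  classical
  rw [or_iff_not_imp_right, not_isEmpty_iff]
  rintro ⟨i₀⟩
  by_contra! hne
  have hdisj : Disjoint (convexHull ℝ (s : Set (ι → ℝ))) (Set.Iic 0) :=
    Set.disjoint_left.2 fun c hc hc' => hne c hc hc'
  obtain ⟨f, u, v, hu, huv, hv⟩ := geometric_hahn_banach_compact_closed
    (convex_convexHull ℝ _) (s.finite_toSet.isCompact_convexHull ℝ)
    (convex_Iic (𝕜 := ℝ) _) isClosed_Iic hdisj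
  have hv0 : v < 0 := by simpa using hv 0 (Set.mem_Iic.2 le_rfl)
  have hf : ∀ c, f c = ∑ i, c i * f (Pi.single i 1) := by
    intro c
    conv_lhs => rw [pi_eq_sum_univ' c, map_sum]
    simp only [map_smul, smul_eq_mul]
  have hx0 : ∀ i, f (Pi.single i 1) ≤ 0 := by
    intro i
    by_contra! hpos
    -- This vector is nonpositive and `f` takes the value exactly `v` on it.
    have := hv ((v / f (Pi.single i 1)) • Pi.single i 1) (by
      rw [Set.mem_Iic]
      exact smul_nonpos_of_nonpos_of_nonneg (div_nonpos_of_nonpos_of_nonneg hv0.le hpos.le)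
        (Pi.single_nonneg.2 zero_le_one))
    rw [map_smul, smul_eq_mul, div_mul_cancel₀ _ hpos.ne'] at this
    exact lt_irrefl _ this
  -- Normalised to sum 1, `y` is a point of the simplex where every form in `s` is positive.
  set y : ι → ℝ := fun i => -f (Pi.single i 1) with hy
  have hy0 : ∀ i, 0 ≤ y i := fun i => neg_nonneg.2 (hx0 i)
  have hfy : ∀ c, ∑ i, c i * y i = -f c := by
    intro c
    simp [hf c, hy]
  have hpos : ∀ c ∈ s, 0 < ∑ i, c i * y i := by
    intro c hc
    have := hu c (subset_convexHull ℝ _ hc)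
    rw [hfy]
    linarith
  obtain ⟨c₀, hc₀, -⟩ := h (Pi.single i₀ 1) (single_mem_stdSimplex ℝ i₀)
  have hsum : 0 < ∑ i, y i := by
    refine lt_of_le_of_ne (Finset.sum_nonneg fun i _ => hy0 i) fun h0 => ?_
    have hz := (Finset.sum_eq_zero_iff_of_nonneg fun i _ => hy0 i).1 h0.symm
    have := hpos c₀ hc₀
    simp [fun i => hz i (Finset.mem_univ i)] at this
  obtain ⟨c, hc, hle⟩ := h (fun i => (∑ j, y j)⁻¹ * y i)
    ⟨fun i => mul_nonneg (inv_nonneg.2 hsum.le) (hy0 i), by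
      rw [← Finset.mul_sum, inv_mul_cancel₀ hsum.ne']⟩
  have h2 : ∑ i, c i * ((∑ j, y j)⁻¹ * y i) = (∑ j, y j)⁻¹ * ∑ i, c i * y i := by
    rw [Finset.mul_sum]
    exact Finset.sum_congr rfl fun i _ => by ring
  rw [h2] at hle
  exact absurd hle (not_le.2 (mul_pos (inv_pos.2 hsum) (hpos c hc)))

/-- The linear form with coefficients `c`, as a continuous function on the standard simplex. -/
def simplexForm : (ι → ℝ) →ₗ[ℝ] C(stdSimplex ℝ ι, ℝ) where
  toFun c := ⟨fun x => ∑ i, c i * (x : ι → ℝ) i,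
    continuous_finsetSum _ fun i _ =>
      continuous_const.mul ((continuous_apply i).comp continuous_subtype_val)⟩
  map_add' c d := by ext x; simp [add_mul, Finset.sum_add_distrib]
  map_smul' a c := by ext x; simp [mul_assoc, Finset.mul_sum]

@[simp]
lemma simplexForm_apply (c : ι → ℝ) (x : stdSimplex ℝ ι) :
    simplexForm c x = ∑ i, c i * (x : ι → ℝ) i := rfl

/-- Coordinates sum to 1, so affine functions on the simplex are linear forms. -/
lemma simplexForm_const (t : ℝ) :
    simplexForm (fun _ : ι => t) = algebraMap ℝ C(stdSimplex ℝ ι, ℝ) t := by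
  ext x
  simp [← Finset.mul_sum]

variable {F : Type*} [AddCommGroup F] [Module ℝ F]

/-- The linear form with coefficients `c`, as a function on the simplex and evaluated at `a`. -/
def pairForm (a : ι → F) : (ι → ℝ) →ₗ[ℝ] C(stdSimplex ℝ ι, ℝ) × F :=
  simplexForm.prod (Fintype.linearCombination ℝ a)

lemma pairForm_apply (a : ι → F) (c : ι → ℝ) :
    pairForm a c = (simplexForm c, ∑ i, c i • a i) := rfl

variable [Lattice F] [IsOrderedAddMonoid F] [IsOrderedModule ℝ F]

/-- A lattice-linear inequality valid on the standard simplex holds for positive elements of any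
vector lattice. -/
lemma snd_nonpos_of_fst_nonpos {a : ι → F} (ha : ∀ i, 0 ≤ a i)
    {z : C(stdSimplex ℝ ι, ℝ) × F} (hz : z ∈ submoduleLatticeClosure (pairForm a).range)
    (h : z.1 ≤ 0) : z.2 ≤ 0 := by
  classical
  obtain ⟨t, ht, hts, rfl⟩ := mem_supClosure_infClosure_of_mem hz
  have hsnd : (t.sup' ht id).2 = t.sup' ht (fun w => w.2) :=
    Finset.apply_sup'_eq_sup'_comp ht (fun w : C(stdSimplex ℝ ι, ℝ) × F => w.2) fun _ _ => rfl
  rw [hsnd]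
  refine Finset.sup'_le _ _ fun w hw => ?_
  have hw1 : w.1 ≤ 0 := le_trans (Finset.le_sup' (f := id) hw).1 h
  obtain ⟨u, hu, hus, rfl⟩ := hts hw
  rw [LinearMap.coe_range, ← Set.image_univ] at hus
  obtain ⟨s, -, rfl⟩ := Finset.subset_set_image_iff.1 hus
  rw [Finset.image_nonempty] at hu
  have hsnd' : ((s.image (pairForm a)).inf' (hu.image _) id).2 =
      s.inf' hu (fun c => (pairForm a c).2) := by
    rw [Finset.inf'_image]
    exact Finset.apply_inf'_eq_inf'_comp hu (fun w : C(stdSimplex ℝ ι, ℝ) × F => w.2)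
      fun _ _ => rfl
  have hmin : ∀ x ∈ stdSimplex ℝ ι, ∃ c ∈ s, ∑ i, c i * x i ≤ 0 := by
    intro x hx
    have hfst : ((s.image (pairForm a)).inf' (hu.image _) id).1 ⟨x, hx⟩ =
        s.inf' hu (fun c => (pairForm a c).1 ⟨x, hx⟩) := by
      rw [Finset.inf'_image]
      exact Finset.apply_inf'_eq_inf'_comp hu
        (fun w : C(stdSimplex ℝ ι, ℝ) × F => w.1 ⟨x, hx⟩) fun _ _ => rfl
    obtain ⟨c, hc, hcx⟩ := Finset.exists_mem_eq_inf' hu (fun c => (pairForm a c).1 ⟨x, hx⟩)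
    refine ⟨c, hc, ?_⟩
    have := hw1 ⟨x, hx⟩
    exact (hfst.trans hcx).symm.le.trans this
  rw [hsnd']
  rcases exists_convexHull_nonpos s hmin with ⟨c, hc, hc0⟩ | hι
  -- A finite infimum lies below every convex combination of its terms; the combination found has
  -- nonpositive coefficients on positive `a i`.
  · have hconv : Convex ℝ {c | s.inf' hu (fun c => (pairForm a c).2) ≤ (pairForm a c).2} :=
      (convex_Ici (𝕜 := ℝ) (s.inf' hu (fun c => (pairForm a c).2))).linear_preimage
        (Fintype.linearCombination ℝ a)
    have h1 := convexHull_min (fun d hd => Finset.inf'_le _ hd) hconv hc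
    refine le_trans h1 (Finset.sum_nonpos fun i _ => ?_)
    exact smul_nonpos_of_nonpos_of_nonneg (hc0 i) (ha i)
  · obtain ⟨c, hc⟩ := hu
    refine (Finset.inf'_le _ hc).trans ?_
    simp [pairForm_apply]

end Transfer

/-! ### Uniform density of sums of positive parts of linear forms. -/

section Density

variable {ι : Type*} [Fintype ι]

/-- Taylor's formula for `exp` at `-M` with integral remainder, which writes `exp` as an affine
function plus a superposition of shifted positive parts. -/
lemma integral_exp_mul_posPart {M t : ℝ} (h1 : -M ≤ t) (h2 : t ≤ M) :
    ∫ s in (-M)..M, Real.exp s * (t - s)⁺ = Real.exp t - Real.exp (-M) * (1 + t + M) := by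
  have hint : ∀ a b : ℝ, IntervalIntegrable (fun s => Real.exp s * (t - s)⁺)
      MeasureTheory.volume a b := fun a b =>
    Continuous.intervalIntegrable (Real.continuous_exp.mul
      (continuous_posPart.comp (continuous_const.sub continuous_id))) a b
  rw [← intervalIntegral.integral_add_adjacent_intervals (hint (-M) t) (hint t M)]
  have e2 : ∫ s in t..M, Real.exp s * (t - s)⁺ = 0 := by
    rw [intervalIntegral.integral_congr (g := fun _ => (0 : ℝ)), intervalIntegral.integral_zero]
    intro s hs
    rw [Set.uIcc_of_le h2] at hs
    simp [posPart_eq_zero.2 (sub_nonpos.2 hs.1)]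
  have e1 : ∫ s in (-M)..t, Real.exp s * (t - s)⁺ =
      ∫ s in (-M)..t, Real.exp s * (t - s) := by
    refine intervalIntegral.integral_congr fun s hs => ?_
    rw [Set.uIcc_of_le h1] at hs
    simp [posPart_of_nonneg (sub_nonneg.2 hs.2)]
  rw [e1, e2, intervalIntegral.integral_eq_sub_of_hasDerivAt
    (f := fun s => Real.exp s * (t - s + 1))]
  · ring_nf
  · intro s _
    have h : HasDerivAt (fun s => Real.exp s * (t - s + 1))
        (Real.exp s * (t - s + 1) + Real.exp s * (-1)) s :=
      (Real.hasDerivAt_exp s).mul (((hasDerivAt_id' s).const_sub t).add_const 1)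
    exact h.congr_deriv (by ring)
  · exact Continuous.intervalIntegrable (by fun_prop) _ _

/-- The closed span of the positive parts of the linear forms on the simplex. -/
def reluSpan (ι : Type*) [Fintype ι] : Submodule ℝ C(stdSimplex ℝ ι, ℝ) :=
  (Submodule.span ℝ (Set.range fun c : ι → ℝ => (simplexForm c)⁺)).topologicalClosure

lemma posPart_simplexForm_mem (c : ι → ℝ) : (simplexForm c)⁺ ∈ reluSpan ι :=
  Submodule.le_topologicalClosure _ (Submodule.subset_span ⟨c, rfl⟩)

lemma simplexForm_mem (c : ι → ℝ) : simplexForm c ∈ reluSpan ι := by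
  rw [← posPart_sub_negPart (simplexForm c), ← posPart_neg, ← map_neg]
  exact sub_mem (posPart_simplexForm_mem c) (posPart_simplexForm_mem _)

/-- The exponential of a linear form, as a continuous function on the simplex. -/
noncomputable def simplexExp (c : ι → ℝ) : C(stdSimplex ℝ ι, ℝ) :=
  ⟨fun x => Real.exp (simplexForm c x), by fun_prop⟩

lemma simplexExp_mem (c : ι → ℝ) : simplexExp c ∈ reluSpan ι := by
  set M := ‖simplexForm c‖
  have hbd : ∀ x, |simplexForm c x| ≤ M := fun x => (simplexForm c).norm_coe_le_norm x
  let g : ℝ → C(stdSimplex ℝ ι, ℝ) := fun s => Real.exp s • (simplexForm (c - fun _ => s))⁺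
  have hlin : Continuous fun s : ℝ => simplexForm (c - fun _ : ι => s) :=
    (LinearMap.continuous_of_finiteDimensional simplexForm).comp (by fun_prop)
  have hg : Continuous g := Real.continuous_exp.smul (continuous_posPart.comp hlin)
  have hmem : ∫ s in (-M)..M, g s ∈ reluSpan ι := by
    -- Integrating inside the complete subspace keeps the integral in it.
    have hgm : ∀ s, g s ∈ reluSpan ι := fun s =>
      Submodule.smul_mem _ _ (posPart_simplexForm_mem _)
    have : CompleteSpace (reluSpan ι) :=
      (Submodule.isClosed_topologicalClosure _).completeSpace_coe
    have hg' : Continuous fun s => (⟨g s, hgm s⟩ : reluSpan ι) := hg.subtype_mk hgm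
    have h := ContinuousLinearMap.intervalIntegral_comp_comm (𝕜 := ℝ) (reluSpan ι).subtypeL
      (hg'.intervalIntegrable (μ := MeasureTheory.volume) (-M) M)
    exact h ▸ Subtype.property _
  have heq : simplexExp c = (∫ s in (-M)..M, g s) +
      Real.exp (-M) • (simplexForm (fun _ => 1 + M) + simplexForm c) := by
    ext x
    have h1 : (∫ s in (-M)..M, g s) x = ∫ s in (-M)..M, g s x :=
      ((ContinuousMap.evalCLM ℝ x).intervalIntegral_comp_comm (hg.intervalIntegrable _ _)).symm
    have h2 : ∀ s, g s x = Real.exp s * (simplexForm c x - s)⁺ := by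
      intro s
      have : simplexForm (c - fun _ : ι => s) x = simplexForm c x - s := by
        rw [map_sub, simplexForm_const]
        simp
      rw [← this]
      rfl
    simp only [ContinuousMap.add_apply, ContinuousMap.smul_apply, h1, h2]
    rw [integral_exp_mul_posPart (abs_le.1 (hbd x)).1 (abs_le.1 (hbd x)).2, simplexForm_const]
    simp [simplexExp]
    ring
  rw [heq]
  exact add_mem hmem (Submodule.smul_mem _ _ (add_mem (simplexForm_mem _) (simplexForm_mem _)))

/-- Exponentials of linear forms make up a multiplicative submonoid. -/
def simplexExpSubmonoid (ι : Type*) [Fintype ι] : Submonoid C(stdSimplex ℝ ι, ℝ) where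
  carrier := Set.range simplexExp
  one_mem' := ⟨0, by ext x; simp [simplexExp]⟩
  mul_mem' := by
    rintro _ _ ⟨c, rfl⟩ ⟨d, rfl⟩
    exact ⟨c + d, by ext x; simp [simplexExp, Real.exp_add]⟩

/-- Linear combinations of positive parts of linear forms are uniformly dense on the simplex. -/
lemma reluSpan_eq_top : reluSpan ι = ⊤ := by
  classical
  -- Exponentials are closed under products, so this algebra is just their span; Stone–Weierstrass
  -- then applies.
  let B := Algebra.adjoin ℝ (simplexExpSubmonoid ι : Set C(stdSimplex ℝ ι, ℝ))
  have hB : Subalgebra.toSubmodule B ≤ reluSpan ι := by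
    rw [Algebra.adjoin_eq_span, Submonoid.closure_eq, Submodule.span_le]
    rintro _ ⟨c, rfl⟩
    exact simplexExp_mem c
  have hsep : B.SeparatesPoints := by
    intro x y hxy
    obtain ⟨i, hi⟩ : ∃ i, (x : ι → ℝ) i ≠ (y : ι → ℝ) i := by
      by_contra! h
      exact hxy (Subtype.ext (funext h))
    refine ⟨_, ⟨simplexExp (Pi.single i 1), Algebra.subset_adjoin ⟨_, rfl⟩, rfl⟩, ?_⟩
    simpa [simplexExp, Pi.single_apply] using hi
  have htop := ContinuousMap.subalgebra_topologicalClosure_eq_top_of_separatesPoints B hsep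
  have hcl : IsClosed (reluSpan ι : Set C(stdSimplex ℝ ι, ℝ)) :=
    Submodule.isClosed_topologicalClosure _
  rw [eq_top_iff]
  intro f _
  have hf : f ∈ B.topologicalClosure := htop ▸ Algebra.mem_top
  exact closure_minimal hB hcl hf

end Density

/-! ### The closed span of positive parts is the closed sublattice generated by `A`. -/

section BanachLattice

variable {F : Type*} [NormedAddCommGroup F] [NormedSpace ℝ F] [Lattice F]

/-- The span of the positive parts of the linear span of `A`. -/
def posPartSpan (A : Set F) : Submodule ℝ F :=
  Submodule.span ℝ ((fun f : F => f⁺) '' (Submodule.span ℝ A : Set F))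

lemma posPartSpan_mono {A B : Set F} (h : A ⊆ B) : posPartSpan A ≤ posPartSpan B :=
  Submodule.span_mono (Set.image_mono (Submodule.span_mono h))

lemma exists_finset_mem_posPartSpan {A : Set F} {u : F} (hu : u ∈ posPartSpan A) :
    ∃ T : Finset F, ↑T ⊆ A ∧ u ∈ posPartSpan (T : Set F) := by
  classical
  induction hu using Submodule.span_induction with
  | mem x hx =>
    obtain ⟨f, hf, rfl⟩ := hx
    obtain ⟨T, hT, hfT⟩ := Submodule.mem_span_finite_of_mem_span hf
    exact ⟨T, hT, Submodule.subset_span ⟨f, hfT, rfl⟩⟩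
  | zero => exact ⟨∅, by simp, zero_mem _⟩
  | add x y _ _ hx hy =>
    obtain ⟨S, hS, hxS⟩ := hx
    obtain ⟨T, hT, hyT⟩ := hy
    refine ⟨S ∪ T, by simp [hS, hT], add_mem (posPartSpan_mono ?_ hxS) (posPartSpan_mono ?_ hyT)⟩
      <;> simp
  | smul c x _ hx =>
    obtain ⟨T, hT, hxT⟩ := hx
    exact ⟨T, hT, Submodule.smul_mem _ _ hxT⟩

lemma posPartSpan_le {A : Set F} {S : Submodule ℝ F} (hS : IsVectorSublattice S) (hA : A ⊆ S) :
    posPartSpan A ≤ S := by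
  rw [posPartSpan, Submodule.span_le]
  rintro _ ⟨f, hf, rfl⟩
  exact hS.posPart_mem (Submodule.span_le.2 hA hf)

lemma posPartSpan_le_vlt (A : Set F) : posPartSpan A ≤ vlt A :=
  le_sInf fun _ hS => posPartSpan_le hS.1 hS.2

variable [IsOrderedAddMonoid F]

lemma span_le_posPartSpan (A : Set F) : Submodule.span ℝ A ≤ posPartSpan A := by
  intro f hf
  rw [← posPart_sub_negPart f, ← posPart_neg]
  exact sub_mem (Submodule.subset_span ⟨f, hf, rfl⟩) (Submodule.subset_span ⟨-f, neg_mem hf, rfl⟩)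

variable [IsOrderedModule ℝ F] [HasSolidNorm F]

/-- Pairs in `C(stdSimplex ℝ ι, ℝ) × F` carry a function and its value at `a` together, so no
functional calculus, nor its well-definedness, is needed. -/
lemma abs_mem_closure_posPartSpan_range {ι : Type*} [Fintype ι] {a : ι → F} (ha : ∀ i, 0 ≤ a i)
    {u : F} (hu : u ∈ posPartSpan (Set.range a)) :
    |u| ∈ (posPartSpan (Set.range a)).topologicalClosure := by
  let P : Submodule ℝ (C(stdSimplex ℝ ι, ℝ) × F) :=
    Submodule.span ℝ (Set.range fun c => (pairForm a c)⁺)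
  let L := submoduleLatticeClosure (pairForm a).range
  have hL : IsVectorSublattice L := isVectorSublattice_submoduleLatticeClosure _
  have hGL : ∀ c, pairForm a c ∈ L := fun c => le_submoduleLatticeClosure _ ⟨c, rfl⟩
  have hPL : P ≤ L := by
    rw [Submodule.span_le]
    rintro _ ⟨c, rfl⟩
    exact hL.posPart_mem (hGL c)
  have hP1 : P.map (LinearMap.fst ℝ _ _) =
      Submodule.span ℝ (Set.range fun c : ι → ℝ => (simplexForm c)⁺) := by
    rw [Submodule.map_span, ← Set.range_comp]
    rfl
  have hP2 : P.map (LinearMap.snd ℝ _ _) = posPartSpan (Set.range a) := by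
    rw [Submodule.map_span, ← Set.range_comp, posPartSpan]
    congr 1
    ext y
    constructor
    · rintro ⟨c, rfl⟩
      exact ⟨∑ i, c i • a i, sum_mem fun i _ => Submodule.smul_mem _ _
        (Submodule.subset_span ⟨i, rfl⟩), rfl⟩
    · rintro ⟨f, hf, rfl⟩
      obtain ⟨c, rfl⟩ := (Submodule.mem_span_range_iff_exists_fun ℝ).1 hf
      exact ⟨c, rfl⟩
  rw [← hP2] at hu
  obtain ⟨z, hz, rfl⟩ := hu
  change |z.2| ∈ closure _
  rw [Metric.mem_closure_iff]
  intro ε hε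
  set e := ∑ i, a i with he
  have hN : 0 < ‖e‖ + 1 := by positivity
  set δ := ε / (‖e‖ + 1)
  have hδ0 : 0 < δ := by positivity
  have hdense : |z.1| ∈ reluSpan ι := by
    rw [reluSpan_eq_top]
    exact Submodule.mem_top
  obtain ⟨q, hq, hdist⟩ := Metric.mem_closure_iff.1 hdense δ hδ0
  rw [SetLike.mem_coe, ← hP1] at hq
  obtain ⟨w, hw, rfl⟩ := hq
  refine ⟨w.2, hP2 ▸ ⟨w, hw, rfl⟩, ?_⟩
  -- The constant coefficient vector `δ` gives the function `δ` on the simplex and `δ • e` in `F`.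
  have hmem : |w - (|z|)| - pairForm a (fun _ : ι => δ) ∈ L :=
    L.sub_mem (hL.abs_mem (L.sub_mem (hPL hw) (hL.abs_mem (hPL hz)))) (hGL _)
  have hle := snd_nonpos_of_fst_nonpos ha hmem (by
    intro x
    have h1 := (w.1 - |z.1|).norm_coe_le_norm x
    have h2 : ‖w.1 - |z.1|‖ < δ := by rwa [dist_comm, dist_eq_norm] at hdist
    have h3 : simplexForm (fun _ : ι => δ) x = δ := by rw [simplexForm_const]; simp
    change |w.1 x - (|z.1 x|)| - simplexForm (fun _ : ι => δ) x ≤ 0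
    rw [h3]
    have h4 : |w.1 x - (|z.1 x|)| ≤ ‖w.1 - |z.1|‖ := h1
    linarith)
  have hle' : |w.2 - (|z.2|)| ≤ |δ • e| := by
    refine le_trans ?_ (le_abs_self _)
    rw [he, Finset.smul_sum]
    exact sub_nonpos.1 hle
  have hnorm : ‖w.2 - |z.2|‖ ≤ ‖δ • e‖ := norm_le_norm_of_abs_le_abs hle'
  rw [dist_comm]
  change dist w.2 |z.2| < ε
  rw [dist_eq_norm]
  refine hnorm.trans_lt ?_
  rw [norm_smul, Real.norm_of_nonneg hδ0.le]
  calc δ * ‖e‖ < δ * (‖e‖ + 1) := by gcongr; linarith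
    _ = ε := div_mul_cancel₀ _ hN.ne'

/-- The closed span of the positive parts of the span of positive elements is a sublattice. -/
lemma isVectorSublattice_closure_posPartSpan {A : Set F} (hA : ∀ a ∈ A, 0 ≤ a) :
    IsVectorSublattice (posPartSpan A).topologicalClosure := by
  have habs : ∀ u ∈ posPartSpan A, |u| ∈ (posPartSpan A).topologicalClosure := by
    intro u hu
    obtain ⟨T, hT, huT⟩ := exists_finset_mem_posPartSpan hu
    have hr : Set.range ((↑) : T → F) = T := by simp
    have h := abs_mem_closure_posPartSpan_range (a := ((↑) : T → F))
      (fun i => hA _ (hT i.2)) (by rwa [hr])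
    rw [hr] at h
    exact Submodule.topologicalClosure_mono (posPartSpan_mono hT) h
  refine isVectorSublattice_of_abs_mem fun x hx => ?_
  have hcont : Continuous fun x : F => |x| := continuous_id.sup continuous_neg
  have hmaps : Set.MapsTo (fun x : F => |x|) (closure (posPartSpan A : Set F))
      (closure (posPartSpan A).topologicalClosure) :=
    Set.MapsTo.closure (fun u hu => habs u hu) hcont
  have := hmaps hx
  rwa [(Submodule.isClosed_topologicalClosure _).closure_eq] at this

lemma isLeast_closure_posPartSpan {A : Set F} (hA : ∀ a ∈ A, 0 ≤ a) :
    IsLeast {S : Submodule ℝ F | IsVectorSublattice S ∧ IsClosed (S : Set F) ∧ A ⊆ S}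
      (posPartSpan A).topologicalClosure := by
  refine ⟨⟨isVectorSublattice_closure_posPartSpan hA, Submodule.isClosed_topologicalClosure _,
    fun a ha => ?_⟩, fun S hS => ?_⟩
  · exact Submodule.le_topologicalClosure _ (span_le_posPartSpan A (Submodule.subset_span ha))
  · exact Submodule.topologicalClosure_minimal _ (posPartSpan_le hS.1 hS.2.2) hS.2.1

lemma closure_vlt_eq {A : Set F} (hA : ∀ a ∈ A, 0 ≤ a) :
    (vlt A).topologicalClosure = (posPartSpan A).topologicalClosure := by
  obtain ⟨⟨h1, h2, h3⟩, -⟩ := isLeast_closure_posPartSpan hA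
  exact le_antisymm (Submodule.topologicalClosure_minimal _ (sInf_le ⟨h1, h3⟩) h2)
    (Submodule.topologicalClosure_mono (posPartSpan_le_vlt A))

end BanachLattice

theorem mainTheorem5 {F : Type*} [NormedAddCommGroup F] [NormedSpace ℝ F] [Lattice F]
    [IsOrderedAddMonoid F] [IsOrderedModule ℝ F] [HasSolidNorm F] [CompleteSpace F]
    (A : Set F) (hA : ∀ a ∈ A, 0 ≤ a) :
    (∀ r s : ℝ, s ≠ -r →
      IsLeast {S : Submodule ℝ F | IsVectorSublattice S ∧ IsClosed (S : Set F) ∧ A ⊆ S}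
        (Submodule.span ℝ
          (latticeActivation r s '' (Submodule.span ℝ A : Set F))).topologicalClosure ∧
      (vlt A).topologicalClosure =
        (Submodule.span ℝ
          (latticeActivation r s '' (Submodule.span ℝ A : Set F))).topologicalClosure) ∧
    (vlt A).topologicalClosure =
      (Submodule.span ℝ
        ((fun f : F => f⁺) '' (Submodule.span ℝ A : Set F))).topologicalClosure := by
  refine ⟨fun r s hrs => ?_, closure_vlt_eq hA⟩
  rw [span_latticeActivation_eq A hA hrs]
  exact ⟨isLeast_closure_posPartSpan hA, closure_vlt_eq hA⟩
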